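/- Let $\mathbb T=\mathbb R/\mathbb Z$ and let $\mathrm{Aut}(\mathbb T^{\mathbb N})$ be the group of all continuous automorphisms of the compact group $\mathbb T^{\mathbb N}$. For an integer $r\ge 1$ let $\nu_r$ be the Haar probability measure on the compact subgroup $\left(\tfrac1r\mathbb Z/\mathbb Z\right)^{\mathbb N}$ of $\mathbb T^{\mathbb N}$, regarded as a measure on $\mathbb T^{\mathbb N}$, and let $\nu_\infty$ be the Haar probability measure on $\mathbb T^{\mathbb N}$. Let $\mu$ be a Borel probability measure on $\mathbb T^{\mathbb N}$ that is invariant under $\mathrm{Aut}(\mathbb T^{\mathbb N})$ and ergodic, i.e. every $\mathrm{Aut}(\mathbb T^{\mathbb N})$-invariant Borel set is $\mu$-null or $\mu$-conull. Then $\mu=\nu_r$ for some $r\in\{1,2,3,\dots\}\cup\{\infty\}$. -/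

import Mathlib

open MeasureTheory

noncomputable section

/-- The infinite-dimensional torus `𝕋^ℕ`, `𝕋 = ℝ/ℤ`, with its product topology, pointwise addition
and product (equivalently, Borel) sigma-algebra. -/
abbrev InfTorus : Type := ℕ → UnitAddCircle

/-- The cyclic subgroup `(1/r)ℤ / ℤ` of order `r` of the circle `ℝ/ℤ`. -/
def circleCyclic (r : ℕ+) : AddSubgroup UnitAddCircle :=
  AddSubgroup.zmultiples (((1 / (r : ℝ) : ℝ)) : UnitAddCircle)

/-- The subgroup `((1/r)ℤ / ℤ)^ℕ` of `𝕋^ℕ`. -/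
def torsionTorus (r : ℕ+) : AddSubgroup InfTorus :=
  AddSubgroup.pi Set.univ (fun _ => circleCyclic r)

theorem circleCyclic_isClosed (r : ℕ+) : IsClosed (circleCyclic r : Set UnitAddCircle) := by
  have h : IsOfFinAddOrder (((1 / (r : ℝ) : ℝ)) : UnitAddCircle) := by
    refine isOfFinAddOrder_iff_nsmul_eq_zero.2 ⟨r, r.pos, ?_⟩
    rw [← AddCircle.coe_nsmul, nsmul_eq_mul,
      mul_one_div_cancel (by exact_mod_cast r.ne_zero), AddCircle.coe_period]
  exact (h.finite_zmultiples).isClosed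

instance torsionTorus_compactSpace (r : ℕ+) : CompactSpace (torsionTorus r) := by
  have h : IsClosed (torsionTorus r : Set InfTorus) := by
    rw [torsionTorus, AddSubgroup.coe_pi]
    exact isClosed_set_pi fun _ _ => circleCyclic_isClosed r
  exact isCompact_iff_compactSpace.1 h.isCompact

/-- `ν_r` for finite `r`: the Haar probability measure of the compact group `((1/r)ℤ / ℤ)^ℕ`,
regarded as a measure on `𝕋^ℕ` by pushing it forward along the inclusion. -/
def nuFin (r : ℕ+) : Measure InfTorus :=
  (Measure.addHaarMeasure (⊤ : TopologicalSpace.PositiveCompacts (torsionTorus r))).map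
    (fun x : torsionTorus r => (x : InfTorus))

/-- `ν_∞`: the Haar probability measure of `𝕋^ℕ`. -/
def nuInfty : Measure InfTorus :=
  Measure.addHaarMeasure (⊤ : TopologicalSpace.PositiveCompacts InfTorus)

/-- Invariance under the group `Aut(𝕋^ℕ)` of all continuous automorphisms. -/
def IsAutInvariant (μ : Measure InfTorus) : Prop :=
  ∀ φ : InfTorus ≃ₜ+ InfTorus, μ.map φ = μ

/-- Ergodicity for the action of `Aut(𝕋^ℕ)`: every invariant measurable set is null or conull. -/
def IsAutErgodic (μ : Measure InfTorus) : Prop :=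
  ∀ s : Set InfTorus, MeasurableSet s → (∀ φ : InfTorus ≃ₜ+ InfTorus, φ ⁻¹' s = s) →
    μ s = 0 ∨ μ sᶜ = 0

end

noncomputable section

open Filter Topology BoundedContinuousFunction

/-! A measure on the torus is determined by its Fourier coefficients `∫ χ_a`, with `a` finitely
supported. Invariance under shears shows that the coefficients at `a` and `a + a k • b` agree when
`b k = 0`. Given `j`, copy `c = a j` into an unused coordinate `k`; shears at `k` then add any
multiple of `c` to each lower coordinate. Averaging over these and letting `k → ∞` replaces the
integrand by its restriction to the `c`-torsion (`integral_torusChar_eq_setIntegral`). By ergodicity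
each `d`-torsion set is null or conull. If none with `d > 0` is conull, every nontrivial coefficient
vanishes, as for Haar measure. Otherwise let `r` be the least conull `d`: the coefficient is 1 if
`r` divides all of `a`, and 0 if not, as for `nuFin r`. -/

/-- The pairing of `𝕋^ℕ` with its dual group `ℤ^(ℕ)`. -/
def torusPairing (a : ℕ →₀ ℤ) : InfTorus →+ UnitAddCircle where
  toFun x := a.sum fun i n => n • x i
  map_zero' := by simp
  map_add' x y := by simp [smul_add, Finsupp.sum_add]

theorem torusPairing_apply (a : ℕ →₀ ℤ) (x : InfTorus) :
    torusPairing a x = a.sum fun i n => n • x i := rfl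

theorem torusPairing_add (a b : ℕ →₀ ℤ) (x : InfTorus) :
    torusPairing (a + b) x = torusPairing a x + torusPairing b x :=
  Finsupp.sum_add_index' (h := fun i n => n • x i) (by simp) (by simp [add_smul])

theorem torusPairing_single (i : ℕ) (n : ℤ) (x : InfTorus) :
    torusPairing (Finsupp.single i n) x = n • x i :=
  Finsupp.sum_single_index (h := fun i n => n • x i) (by simp)

theorem torusPairing_zero (x : InfTorus) : torusPairing 0 x = 0 :=
  Finsupp.sum_zero_index (h := fun i (n : ℤ) => n • x i)

theorem torusPairing_neg (a : ℕ →₀ ℤ) (x : InfTorus) :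
    torusPairing (-a) x = -torusPairing a x := by
  rw [eq_neg_iff_add_eq_zero, ← torusPairing_add, neg_add_cancel, torusPairing_zero]

theorem torusPairing_zsmul (c : ℤ) (a : ℕ →₀ ℤ) (x : InfTorus) :
    torusPairing (c • a) x = c • torusPairing a x := by
  rw [torusPairing_apply, torusPairing_apply, Finsupp.sum_smul_index' (by simp), Finsupp.smul_sum]
  simp [mul_smul]

theorem torusPairing_finset_sum {ι : Type*} (s : Finset ι) (b : ι → ℕ →₀ ℤ) (x : InfTorus) :
    torusPairing (∑ i ∈ s, b i) x = ∑ i ∈ s, torusPairing (b i) x :=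
  map_sum (AddMonoidHom.mk' (fun a => torusPairing a x) fun a b => torusPairing_add a b x) b s

theorem torusPairing_piSingle (a : ℕ →₀ ℤ) (k : ℕ) (t : UnitAddCircle) :
    torusPairing a (Pi.single k t) = a k • t := by
  rw [torusPairing_apply, Finsupp.sum, Finset.sum_eq_single k]
  · simp
  · intro i _ hi
    simp [Pi.single_eq_of_ne hi]
  · intro hk
    simp [Finsupp.notMem_support_iff.1 hk]

theorem continuous_torusPairing (a : ℕ →₀ ℤ) : Continuous (torusPairing a) :=
  continuous_finsetSum _ fun i _ => (continuous_apply i).zsmul _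

/-- The character `x ↦ exp (2πi ∑ aᵢ xᵢ)` of `𝕋^ℕ`. -/
def torusChar (a : ℕ →₀ ℤ) (x : InfTorus) : ℂ :=
  (AddCircle.toCircle (torusPairing a x) : Circle)

theorem continuous_torusChar (a : ℕ →₀ ℤ) : Continuous (torusChar a) :=
  continuous_subtype_val.comp (AddCircle.continuous_toCircle.comp (continuous_torusPairing a))

theorem norm_torusChar (a : ℕ →₀ ℤ) (x : InfTorus) : ‖torusChar a x‖ = 1 :=
  Circle.norm_coe _

theorem torusChar_zero : torusChar 0 = 1 := by
  ext x
  simp [torusChar, torusPairing_zero]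

theorem torusChar_add (a b : ℕ →₀ ℤ) (x : InfTorus) :
    torusChar (a + b) x = torusChar a x * torusChar b x := by
  simp [torusChar, torusPairing_add, AddCircle.toCircle_add]

theorem torusChar_neg (a : ℕ →₀ ℤ) (x : InfTorus) :
    torusChar (-a) x = star (torusChar a x) := by
  rw [torusChar, torusChar, torusPairing_neg, AddCircle.toCircle_neg, Circle.coe_inv_eq_conj]
  rfl

theorem torusChar_apply_add (a : ℕ →₀ ℤ) (x y : InfTorus) :
    torusChar a (x + y) = torusChar a x * torusChar a y := by
  simp [torusChar, AddCircle.toCircle_add]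

theorem torusChar_eq_one_iff (a : ℕ →₀ ℤ) (x : InfTorus) :
    torusChar a x = 1 ↔ torusPairing a x = 0 := by
  rw [torusChar, Circle.coe_eq_one, ← AddCircle.toCircle_zero (T := (1 : ℝ))]
  exact (AddCircle.injective_toCircle one_ne_zero).eq_iff

theorem integrable_torusChar (μ : Measure InfTorus) [IsFiniteMeasure μ] (a : ℕ →₀ ℤ) :
    Integrable (torusChar a) μ :=
  .of_bound (continuous_torusChar a).aestronglyMeasurable 1
    (.of_forall fun x => (norm_torusChar a x).le)

/-! ### Uniqueness of Fourier coefficients -/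

/-- A character of `𝕋^ℕ` as a bounded continuous function. -/
def torusCharBCF (a : ℕ →₀ ℤ) : InfTorus →ᵇ ℂ :=
  BoundedContinuousFunction.ofNormedAddCommGroup (torusChar a) (continuous_torusChar a) 1
    fun x => (norm_torusChar a x).le

/-- The star subalgebra of trigonometric polynomials on `𝕋^ℕ`. -/
def torusTrigPoly : StarSubalgebra ℂ (InfTorus →ᵇ ℂ) where
  toSubalgebra := Algebra.adjoin ℂ (Set.range torusCharBCF)
  star_mem' := by
    change Algebra.adjoin ℂ (Set.range torusCharBCF) ≤
      star (Algebra.adjoin ℂ (Set.range torusCharBCF))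
    refine Algebra.adjoin_le ?_
    rintro _ ⟨a, rfl⟩
    refine Algebra.subset_adjoin ⟨-a, ?_⟩
    ext x
    exact torusChar_neg a x

/-- Products of characters are characters, so the algebra they generate is already their linear
span. -/
theorem torusTrigPoly_toSubmodule :
    Subalgebra.toSubmodule torusTrigPoly.toSubalgebra
      = Submodule.span ℂ (Set.range torusCharBCF) := by
  apply Algebra.adjoin_eq_span_of_subset
  refine .trans (fun x ↦ Submonoid.closure_induction (fun _ ↦ id) ⟨0, ?_⟩ ?_)
    Submodule.subset_span
  · ext x
    exact congrFun torusChar_zero x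
  · rintro _ _ _ _ ⟨a, rfl⟩ ⟨b, rfl⟩
    refine ⟨a + b, ?_⟩
    ext x
    exact torusChar_add a b x

/-- Finite measures on `𝕋^ℕ` are determined by their Fourier coefficients. -/
theorem measure_ext_of_integral_torusChar {μ ν : Measure InfTorus} [IsFiniteMeasure μ]
    [IsFiniteMeasure ν] (h : ∀ a, ∫ x, torusChar a x ∂μ = ∫ x, torusChar a x ∂ν) : μ = ν := by
  refine ext_of_forall_mem_subalgebra_integral_eq_of_polish (𝕜 := ℂ) (A := torusTrigPoly) ?_ ?_
  · intro x y hxy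
    obtain ⟨i, hi⟩ := Function.ne_iff.1 hxy
    refine ⟨torusChar (Finsupp.single i 1), ⟨toContinuousMapStarₐ ℂ
      (torusCharBCF (Finsupp.single i 1)), ⟨_, Algebra.subset_adjoin ⟨_, rfl⟩, rfl⟩, rfl⟩, ?_⟩
    simp only [torusChar, torusPairing_single, one_smul, ne_eq, Circle.coe_inj]
    exact fun h => hi (AddCircle.injective_toCircle one_ne_zero h)
  · intro g hg
    have hg' : g ∈ Submodule.span ℂ (Set.range torusCharBCF) := by
      rw [← torusTrigPoly_toSubmodule]
      exact hg
    clear hg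
    induction hg' using Submodule.span_induction with
    | mem g hg =>
      obtain ⟨a, rfl⟩ := hg
      exact h a
    | zero => simp
    | add f g hf hg ihf ihg =>
      simp only [BoundedContinuousFunction.coe_add, Pi.add_apply]
      rw [integral_add (f.integrable μ) (g.integrable μ),
        integral_add (f.integrable ν) (g.integrable ν), ihf, ihg]
    | smul c f hf ih => simp only [BoundedContinuousFunction.coe_smul, integral_smul, ih]

/-! ### Shears and their dual action -/

/-- The automorphism of `𝕋^ℕ` that adds `⟨b, x⟩` to the `k`-th coordinate of `x`, where the
character `b` does not involve this coordinate. -/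
def torusShear (k : ℕ) (b : ℕ →₀ ℤ) (hb : b k = 0) : InfTorus ≃ₜ+ InfTorus where
  toFun x := x + Pi.single k (torusPairing b x)
  invFun x := x - Pi.single k (torusPairing b x)
  -- As `b k = 0`, the shear leaves `torusPairing b` unchanged, so subtraction undoes it.
  left_inv x := by simp [torusPairing_piSingle, hb]
  right_inv x := by simp [torusPairing_piSingle, hb]
  map_add' x y := by
    simp only [map_add, Pi.single_add]
    abel
  continuous_toFun := by
    have := continuous_torusPairing b
    change Continuous fun x : InfTorus => x + Pi.single k (torusPairing b x)
    exact continuous_id.add ((continuous_single (A := fun _ => UnitAddCircle) k).comp this)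
  continuous_invFun := by
    have := continuous_torusPairing b
    change Continuous fun x : InfTorus => x - Pi.single k (torusPairing b x)
    exact continuous_id.sub ((continuous_single (A := fun _ => UnitAddCircle) k).comp this)

theorem torusChar_torusShear (a : ℕ →₀ ℤ) (k : ℕ) (b : ℕ →₀ ℤ) (hb : b k = 0) (x : InfTorus) :
    torusChar a (torusShear k b hb x) = torusChar (a + a k • b) x := by
  change torusChar a (x + Pi.single k (torusPairing b x)) = _
  simp only [torusChar, map_add, torusPairing_piSingle, torusPairing_add, torusPairing_zsmul]

theorem IsAutInvariant.integral_torusChar_add {μ : Measure InfTorus} (hinv : IsAutInvariant μ)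
    (a : ℕ →₀ ℤ) (k : ℕ) (b : ℕ →₀ ℤ) (hb : b k = 0) :
    ∫ x, torusChar (a + a k • b) x ∂μ = ∫ x, torusChar a x ∂μ := by
  conv_rhs => rw [← hinv (torusShear k b hb)]
  have hm : Measurable (torusShear k b hb) := (torusShear k b hb).continuous_toFun.measurable
  rw [integral_map hm.aemeasurable (continuous_torusChar a).aestronglyMeasurable]
  exact integral_congr_ae (.of_forall fun x => (torusChar_torusShear a k b hb x).symm)

/-! ### Averaging over shears -/

/-- The Cesàro mean of the first `k` powers of `z`. -/
def powerMean (k : ℕ) (z : ℂ) : ℂ := (k : ℂ)⁻¹ * ∑ n ∈ Finset.range k, z ^ n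

theorem powerMean_one {k : ℕ} (hk : k ≠ 0) : powerMean k 1 = 1 := by
  simp [powerMean, hk]

theorem norm_powerMean_le_one (k : ℕ) {z : ℂ} (hz : ‖z‖ = 1) : ‖powerMean k z‖ ≤ 1 := by
  rw [powerMean, norm_mul, norm_inv, Complex.norm_natCast]
  have h : ‖∑ n ∈ Finset.range k, z ^ n‖ ≤ k := by
    refine (norm_sum_le _ _).trans ?_
    simp [hz]
  calc (k : ℝ)⁻¹ * ‖∑ n ∈ Finset.range k, z ^ n‖ ≤ (k : ℝ)⁻¹ * k := by gcongr
    _ ≤ 1 := inv_mul_le_one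

/-- For `z ≠ 1` on the unit circle the geometric sums stay bounded by `2 / ‖z - 1‖`. -/
theorem tendsto_powerMean {z : ℂ} (hz : ‖z‖ = 1) (hz1 : z ≠ 1) :
    Tendsto (fun k => powerMean k z) atTop (𝓝 0) := by
  have hbound : ∀ k : ℕ, ‖powerMean k z‖ ≤ (k : ℝ)⁻¹ * (2 / ‖z - 1‖) := by
    intro k
    rw [powerMean, norm_mul, norm_inv, Complex.norm_natCast, geom_sum_eq hz1, norm_div]
    gcongr
    refine (norm_sub_le _ _).trans ?_
    norm_num [hz]
  refine squeeze_zero_norm hbound ?_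
  simpa using (tendsto_inv_atTop_nhds_zero_nat (𝕜 := ℝ)).mul_const (2 / ‖z - 1‖)

/-- The closed subgroup of `𝕋^ℕ` of the elements killed by `d`, as a set. -/
def torusTorsion (d : ℤ) : Set InfTorus := {x | d • x = 0}

theorem isClosed_torusTorsion (d : ℤ) : IsClosed (torusTorsion d) :=
  isClosed_eq (continuous_id.zsmul d) continuous_const

theorem preimage_torusTorsion (d : ℤ) (φ : InfTorus ≃ₜ+ InfTorus) :
    φ ⁻¹' torusTorsion d = torusTorsion d := by
  ext x
  simp only [torusTorsion, Set.mem_preimage, Set.mem_ofPred_eq, ← map_zsmul]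
  exact map_eq_zero_iff φ φ.injective

/-- The left side is the average of the coefficients at `a + c e_k + c b`, where `c = a j` and `b`
ranges over the box `{0, …, k-1}^k`; all of them equal the coefficient at `a`. -/
theorem integral_torusChar_eq_integral_mul_prod {μ : Measure InfTorus} [IsProbabilityMeasure μ]
    (hinv : IsAutInvariant μ) (a : ℕ →₀ ℤ) (j : ℕ) {k : ℕ} (hk : a k = 0) (hjk : k ≠ j)
    (hk0 : k ≠ 0) :
    ∫ x, torusChar (a + Finsupp.single k (a j)) x *
      ∏ i : Fin k, powerMean k (torusChar (Finsupp.single i (a j)) x) ∂μ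
      = ∫ x, torusChar a x ∂μ := by
  set c := a j with hc
  set a' := a + Finsupp.single k c with ha'
  have ha'k : a' k = c := by simp [ha', hk]
  -- Adding `x k` to the `j`-th coordinate creates the entry `c` at `k`.
  have h₁ : ∫ x, torusChar a' x ∂μ = ∫ x, torusChar a x ∂μ := by
    have := hinv.integral_torusChar_add a j (Finsupp.single k 1) (by simp [hjk])
    simpa [← hc, ← ha'] using this
  have h₂ : ∀ n : Fin k → ℕ,
      ∫ x, torusChar (a' + ∑ i : Fin k, c • Finsupp.single (i : ℕ) (n i : ℤ)) x ∂μ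
        = ∫ x, torusChar a x ∂μ := by
    intro n
    rw [← h₁, ← hinv.integral_torusChar_add a' k
      (∑ i : Fin k, Finsupp.single (i : ℕ) (n i : ℤ)) ?_, ha'k, Finset.smul_sum]
    rw [Finsupp.finsetSum_apply]
    exact Finset.sum_eq_zero fun i _ => Finsupp.single_eq_of_ne i.2.ne'
  have h₃ : ∀ x : InfTorus, torusChar a' x *
      ∏ i : Fin k, powerMean k (torusChar (Finsupp.single i c) x)
      = ((k : ℂ)⁻¹) ^ k * ∑ n ∈ Fintype.piFinset fun _ : Fin k => Finset.range k,
        torusChar (a' + ∑ i : Fin k, c • Finsupp.single (i : ℕ) (n i : ℤ)) x := by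
    intro x
    simp only [powerMean, Finset.prod_mul_distrib, Finset.prod_univ_sum, torusChar_add,
      ← Finset.mul_sum, Finset.prod_const, Finset.card_univ, Fintype.card_fin]
    rw [mul_left_comm]
    congr 2
    refine Finset.sum_congr rfl fun n _ => ?_
    have : ∀ i : Fin k, torusChar (Finsupp.single (i : ℕ) c) x ^ n i
        = (AddCircle.toCircle (torusPairing (c • Finsupp.single (i : ℕ) (n i : ℤ)) x) : Circle) := by
      intro i
      rw [torusPairing_zsmul, torusPairing_single, natCast_zsmul, smul_comm,
        AddCircle.toCircle_nsmul, torusChar, torusPairing_single]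
      simp
    simp only [this]
    simp only [torusChar, torusPairing_finset_sum]
    generalize (Finset.univ : Finset (Fin k)) = s
    induction s using Finset.cons_induction with
    | empty => simp
    | cons i s hi ih =>
      rw [Finset.prod_cons, Finset.sum_cons, ih, AddCircle.toCircle_add, Circle.coe_mul]
  simp only [h₃]
  rw [integral_const_mul, integral_finsetSum _ fun n _ => integrable_torusChar μ _]
  simp only [h₂, Finset.sum_const, Fintype.card_piFinset, Finset.card_range, Finset.prod_const,
    Finset.card_univ, Fintype.card_fin, nsmul_eq_mul]
  rw [← mul_assoc, Nat.cast_pow, ← mul_pow, inv_mul_cancel₀ (by exact_mod_cast hk0), one_pow,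
    one_mul]

/-- The Fourier coefficients of an invariant measure are concentrated on torsion elements. -/
theorem integral_torusChar_eq_setIntegral {μ : Measure InfTorus} [IsProbabilityMeasure μ]
    (hinv : IsAutInvariant μ) (a : ℕ →₀ ℤ) (j : ℕ) :
    ∫ x, torusChar a x ∂μ = ∫ x in torusTorsion (a j), torusChar a x ∂μ := by
  have hlim : Tendsto (fun k : ℕ => ∫ x, torusChar (a + Finsupp.single k (a j)) x *
      ∏ i : Fin k, powerMean k (torusChar (Finsupp.single i (a j)) x) ∂μ) atTop
      (𝓝 (∫ x, (torusTorsion (a j)).indicator (torusChar a) x ∂μ)) := by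
    refine tendsto_integral_of_dominated_convergence (fun _ => 1) ?_ (integrable_const _) ?_ ?_
    · intro k
      refine Continuous.aestronglyMeasurable ?_
      refine (continuous_torusChar _).mul (continuous_finsetProd _ fun i _ => ?_)
      exact continuous_const.mul
        (continuous_finsetSum _ fun n _ => (continuous_torusChar _).pow n)
    · refine fun k => .of_forall fun x => ?_
      rw [norm_mul, norm_torusChar, one_mul, norm_prod]
      exact Finset.prod_le_one (fun _ _ => norm_nonneg _)
        fun i _ => norm_powerMean_le_one k (norm_torusChar _ x)
    · refine .of_forall fun x => ?_
      have hone : ∀ i, torusChar (Finsupp.single i (a j)) x = 1 ↔ a j • x i = 0 := fun i => by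
        rw [torusChar_eq_one_iff, torusPairing_single]
      by_cases hx : x ∈ torusTorsion (a j)
      · rw [Set.indicator_of_mem hx]
        refine tendsto_const_nhds.congr' ?_
        -- `powerMean 0 1` is 0, not 1.
        filter_upwards [eventually_ne_atTop 0] with k hk
        have hx' : ∀ i, torusChar (Finsupp.single i (a j)) x = 1 := fun i =>
          (hone i).2 (congrFun hx i)
        simp [torusChar_add, hx', powerMean_one hk]
      · rw [Set.indicator_of_notMem hx]
        obtain ⟨i, hi⟩ : ∃ i, a j • x i ≠ 0 := by
          by_contra! h
          exact hx (funext h)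
        -- One factor tends to 0 and the others have norm at most 1, so the whole product tends to
        -- 0.
        have hi0 : Tendsto (fun k => ‖powerMean k (torusChar (Finsupp.single i (a j)) x)‖) atTop
            (𝓝 0) := by
          simpa using (tendsto_powerMean (norm_torusChar _ x) (mt (hone i).1 hi)).norm
        refine squeeze_zero_norm' ?_ hi0
        filter_upwards [eventually_gt_atTop i] with k hk
        rw [norm_mul, norm_torusChar, one_mul, norm_prod,
          ← Finset.mul_prod_erase Finset.univ _ (Finset.mem_univ (⟨i, hk⟩ : Fin k))]
        exact mul_le_of_le_one_right (norm_nonneg _) (Finset.prod_le_one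
          (fun _ _ => norm_nonneg _) fun l _ => norm_powerMean_le_one k (norm_torusChar _ x))
  rw [integral_indicator (isClosed_torusTorsion _).measurableSet] at hlim
  refine tendsto_nhds_unique (tendsto_const_nhds.congr' ?_) hlim
  -- Beyond the support `a k = 0`.
  filter_upwards [eventually_gt_atTop (a.support.sup id), eventually_gt_atTop j] with k hk hjk
  refine (integral_torusChar_eq_integral_mul_prod hinv a j ?_ hjk.ne' (by omega)).symm
  by_contra h
  exact absurd (Finset.le_sup (f := id) (Finsupp.mem_support_iff.2 h)) (not_le.2 hk)

/-! ### Fourier coefficients of the Haar measures -/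

theorem integral_eq_zero_of_map_add {G : Type*} [AddGroup G] [MeasurableSpace G]
    [MeasurableAdd G] (μ : Measure G) [μ.IsAddLeftInvariant] {f : G → ℂ} {t : G} {ζ : ℂ}
    (hζ : ζ ≠ 1) (hf : ∀ x, f (t + x) = ζ * f x) : ∫ x, f x ∂μ = 0 := by
  have h := integral_add_left_eq_self (μ := μ) f t
  simp only [hf, integral_const_mul] at h
  by_contra h0
  exact hζ (mul_right_cancel₀ h0 (h.trans (one_mul _).symm))

instance isProbabilityMeasure_nuInfty : IsProbabilityMeasure nuInfty :=
  ⟨Measure.addHaarMeasure_self⟩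

instance isProbabilityMeasure_nuFin (r : ℕ+) : IsProbabilityMeasure (nuFin r) := by
  have : IsProbabilityMeasure (Measure.addHaarMeasure
      (⊤ : TopologicalSpace.PositiveCompacts (torsionTorus r))) :=
    ⟨Measure.addHaarMeasure_self⟩
  exact Measure.isProbabilityMeasure_map measurable_subtype_coe.aemeasurable

theorem zsmul_one_div_eq_zero_iff (r : ℕ+) (d : ℤ) :
    d • (((1 / (r : ℝ) : ℝ)) : UnitAddCircle) = 0 ↔ (r : ℤ) ∣ d := by
  rw [← addOrderOf_dvd_iff_zsmul_eq_zero]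
  have : addOrderOf (((1 / (r : ℝ) : ℝ)) : UnitAddCircle) = r :=
    AddCircle.addOrderOf_period_div r.pos
  rw [this]

theorem torsionTorus_subset_torusTorsion (r : ℕ+) :
    (torsionTorus r : Set InfTorus) ⊆ torusTorsion r := by
  intro x hx
  funext i
  obtain ⟨n, hn⟩ := hx i (Set.mem_univ i)
  change (r : ℤ) • x i = 0
  rw [← hn]
  change (r : ℤ) • n • _ = _
  rw [smul_comm, (zsmul_one_div_eq_zero_iff r r).2 dvd_rfl, smul_zero]

theorem torusChar_eq_one_of_mem_torusTorsion {a : ℕ →₀ ℤ} {d : ℤ} (h : ∀ i, d ∣ a i)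
    {x : InfTorus} (hx : x ∈ torusTorsion d) : torusChar a x = 1 := by
  rw [torusChar_eq_one_iff, torusPairing_apply]
  refine Finset.sum_eq_zero fun i _ => ?_
  obtain ⟨m, hm⟩ := h i
  have hi : d • x i = 0 := congrFun hx i
  change a i • x i = 0
  rw [hm, mul_comm, mul_smul, hi, smul_zero]

theorem integral_torusChar_nuInfty {a : ℕ →₀ ℤ} (ha : a ≠ 0) :
    ∫ x, torusChar a x ∂nuInfty = 0 := by
  obtain ⟨j, hj⟩ := Finsupp.ne_iff.1 ha
  obtain ⟨t, ht⟩ : ∃ t : UnitAddCircle, a j • t ≠ 0 := by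
    -- `|a j| + 1` is too large to divide the nonzero `a j`.
    obtain ⟨r, hr⟩ : ∃ r : ℕ+, ¬ (r : ℤ) ∣ a j :=
      ⟨⟨(a j).natAbs + 1, Nat.succ_pos _⟩, fun h => by
        have := Int.natAbs_le_of_dvd_ne_zero h hj
        exact absurd (this.trans_lt (Nat.lt_succ_self _)) (by
          rw [Int.natAbs_natCast]
          exact lt_irrefl _)⟩
    exact ⟨_, mt (zsmul_one_div_eq_zero_iff r _).1 hr⟩
  unfold nuInfty
  refine integral_eq_zero_of_map_add _ (t := Pi.single j t)
    (ζ := torusChar a (Pi.single j t)) ?_ (torusChar_apply_add a _)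
  rwa [Ne, torusChar_eq_one_iff, torusPairing_piSingle]

theorem integral_torusChar_nuFin_of_dvd {r : ℕ+} {a : ℕ →₀ ℤ} (h : ∀ i, (r : ℤ) ∣ a i) :
    ∫ x, torusChar a x ∂nuFin r = 1 := by
  have : IsProbabilityMeasure (Measure.addHaarMeasure
      (⊤ : TopologicalSpace.PositiveCompacts (torsionTorus r))) :=
    ⟨Measure.addHaarMeasure_self⟩
  rw [nuFin, integral_map measurable_subtype_coe.aemeasurable
    (continuous_torusChar a).aestronglyMeasurable]
  simp [torusChar_eq_one_of_mem_torusTorsion h (torsionTorus_subset_torusTorsion r (Subtype.prop _))]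

theorem integral_torusChar_nuFin_of_not_dvd {r : ℕ+} {a : ℕ →₀ ℤ} {j : ℕ}
    (h : ¬ (r : ℤ) ∣ a j) : ∫ x, torusChar a x ∂nuFin r = 0 := by
  rw [nuFin, integral_map measurable_subtype_coe.aemeasurable
    (continuous_torusChar a).aestronglyMeasurable]
  have ht : Pi.single j (((1 / (r : ℝ) : ℝ)) : UnitAddCircle) ∈ torsionTorus r := by
    intro i _
    rcases eq_or_ne i j with rfl | hij
    · simp [circleCyclic]
    · simp [Pi.single_eq_of_ne hij]
  refine integral_eq_zero_of_map_add _ (t := (⟨_, ht⟩ : torsionTorus r))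
    (ζ := torusChar a (Pi.single j _)) ?_ fun x => torusChar_apply_add a _ x
  rwa [Ne, torusChar_eq_one_iff, torusPairing_piSingle, zsmul_one_div_eq_zero_iff]

/-- Bézout's identity. -/
theorem torusTorsion_inter_subset (d e : ℤ) :
    torusTorsion d ∩ torusTorsion e ⊆ torusTorsion (d.gcd e) := by
  rintro x ⟨hd, he⟩
  change ((d.gcd e : ℕ) : ℤ) • x = 0
  have hd' : d • x = 0 := hd
  have he' : e • x = 0 := he
  rw [Int.gcd_eq_gcd_ab, add_smul, mul_comm d, mul_comm e, mul_smul, mul_smul, hd', he']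
  simp

end

/-! ### Ergodic dichotomy and classification -/

theorem theoremT0 (μ : Measure InfTorus) [IsProbabilityMeasure μ]
    (hinv : IsAutInvariant μ) (herg : IsAutErgodic μ) :
    μ = nuInfty ∨ ∃ r : ℕ+, μ = nuFin r := by
  have hdich : ∀ d : ℤ, μ (torusTorsion d) = 0 ∨ ∀ᵐ x ∂μ, x ∈ torusTorsion d := fun d =>
    herg _ (isClosed_torusTorsion d).measurableSet (preimage_torusTorsion d)
  have hzero : ∀ (a : ℕ →₀ ℤ) (j : ℕ), μ (torusTorsion (a j)) = 0 →
      ∫ x, torusChar a x ∂μ = 0 := fun a j h => by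
    rw [integral_torusChar_eq_setIntegral hinv a j, setIntegral_measure_zero _ h]
  by_cases hS : ∃ d : ℕ, 0 < d ∧ ∀ᵐ x ∂μ, x ∈ torusTorsion d
  · classical
    right
    obtain ⟨hr, hrμ⟩ := Nat.find_spec hS
    have hmin := fun m => Nat.find_min hS (m := m)
    generalize Nat.find hS = r at hr hrμ hmin
    lift r to ℕ+ using hr
    refine ⟨r, measure_ext_of_integral_torusChar fun a => ?_⟩
    by_cases ha : ∀ i, (r : ℤ) ∣ a i
    · rw [integral_torusChar_nuFin_of_dvd ha, integral_congr_ae (g := fun _ => 1)]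
      · simp
      · filter_upwards [hrμ] with x hx using torusChar_eq_one_of_mem_torusTorsion ha hx
    · obtain ⟨j, hj⟩ := not_forall.1 ha
      rw [integral_torusChar_nuFin_of_not_dvd hj]
      -- If the `a j`-torsion were conull, so would be the torsion of `gcd (a j) r < r`, against
      -- minimality of `r`.
      refine hzero a j ((hdich (a j)).resolve_right fun hc => ?_)
      have hpos : 0 < (a j).gcd r := Int.gcd_pos_of_ne_zero_right _ (by exact_mod_cast r.ne_zero)
      have hne : (a j).gcd r ≠ r := fun h =>
        hj (by simpa only [h] using Int.gcd_dvd_left (a j) r)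
      have hlt : (a j).gcd r < r :=
        lt_of_le_of_ne (Nat.le_of_dvd r.pos (by exact_mod_cast Int.gcd_dvd_right (a j) r)) hne
      refine hmin _ hlt ⟨hpos, ?_⟩
      filter_upwards [hc, hrμ] with x h₁ h₂ using torusTorsion_inter_subset _ _ ⟨h₁, h₂⟩
  · left
    refine measure_ext_of_integral_torusChar fun a => ?_
    rcases eq_or_ne a 0 with rfl | ha
    · simp [torusChar_zero]
    · rw [integral_torusChar_nuInfty ha]
      obtain ⟨j, hj⟩ := Finsupp.ne_iff.1 ha
      refine hzero a j ((hdich (a j)).resolve_right fun hc => hS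
        ⟨(a j).natAbs, Int.natAbs_pos.2 hj, ?_⟩)
      filter_upwards [hc] with x hx
      have hx' : a j • x = 0 := hx
      change ((a j).natAbs : ℤ) • x = 0
      rcases Int.natAbs_eq (a j) with h | h
      · rw [← h, hx']
      · rw [← neg_eq_zero, ← neg_smul, ← h, hx']
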